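/- Let $\mathbb{P}_1$ be the set of polynomials in $\mathbb{Q}[x]$ of degree at least one with zero constant term, that is, the set of nonzero elements of $x\mathbb{Q}[x]$. Let $F$ be a finite set of positive integers. Then for every colouring of $\mathbb{P}_1$ with finitely many colours there are $p, q\in\mathbb{P}_1$ such that the set $$\{pq\}\cup\left\{p+\tfrac{q}{f} : f\in F\right\}$$ is contained in $\mathbb{P}_1$ and is monochromatic, i.e. all its elements receive the same colour. -/

import Mathlib

open Polynomial

/-- The space `x ℚ[x]` of rational polynomials of degree at least one with zero constant term.
The zero polynomial is not a member. -/
def polySpaceOne : Set ℚ[X] := {p | X ∣ p ∧ 1 ≤ p.natDegree}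

theorem mem_polySpaceOne_iff (p : ℚ[X]) : p ∈ polySpaceOne ↔ p.coeff 0 = 0 ∧ p ≠ 0 := by
  unfold polySpaceOne
  rw [Set.mem_ofPred_eq, X_dvd_iff]
  refine and_congr_right fun h => ⟨?_, ?_⟩
  · rintro h1 rfl
    simp at h1
  · intro h0
    by_contra h1
    have h2 : p.natDegree = 0 := by omega
    rw [eq_C_of_natDegree_eq_zero h2, h] at h0
    simp at h0

/-- A set of polynomials is monochromatic for a colouring `c` of `polySpaceOne` if it lies inside
`polySpaceOne` and all of its members receive one and the same colour. -/
def IsMonochromatic {r : ℕ} (c : polySpaceOne → Fin r) (S : Set ℚ[X]) : Prop :=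
  ∃ k : Fin r, ∀ p ∈ S, ∃ h : p ∈ polySpaceOne, c ⟨p, h⟩ = k

/-! Collect colours `t` with multipliers `g t` such that each `g t * A` has colour `t`, for one
frequent set `A`. Writing a common multiple as `m = g t * k t`, Gallai–Brown gives frequently many
`v` with `v` and all `v + N * k t ^ 2 / f` in `A`. If `m ^ 2 * N * v` has a collected colour `t`,
then `x = g t * v`, `y = g t * k t ^ 2 * N` work; otherwise a new colour is collected, which can
happen at most `r` times. -/

open Filter in
/-- On an infinite abelian group there is a translation-invariant filter, finer than the cofinite
filter, for which every frequent set is syndetic. -/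
theorem exists_invariant_filter (V : Type*) [AddCommGroup V] [Infinite V] :
    ∃ l : Filter V, l.NeBot ∧ l ≤ cofinite ∧ (∀ v, Tendsto (· + v) l l) ∧
      ∀ A : Set V, (∃ᶠ v in l, v ∈ A) → ∃ H : Finset V, ∀ᶠ v in l, ∃ h ∈ H, v + h ∈ A := by
  -- In the order dual, Zorn's maximal element is a finest invariant filter.
  let Z : Set (Filter V)ᵒᵈ := {l | (OrderDual.ofDual l).NeBot ∧ OrderDual.ofDual l ≤ cofinite ∧
    ∀ v, Tendsto (· + v) (OrderDual.ofDual l) (OrderDual.ofDual l)}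
  have hcof : OrderDual.toDual (cofinite : Filter V) ∈ Z :=
    ⟨inferInstanceAs (cofinite : Filter V).NeBot, le_rfl, fun v => (add_left_injective v).tendsto_cofinite⟩
  obtain ⟨m, -, hm⟩ := zorn_le_nonempty₀ Z (fun c hcZ hc y hy => by
    refine ⟨OrderDual.toDual (sInf (OrderDual.ofDual '' c)), ⟨?_, ?_, ?_⟩, ?_⟩
    · refine sInf_neBot_of_directed ?_ ?_
      · rintro _ ⟨a, ha, rfl⟩ _ ⟨b, hb, rfl⟩
        rcases hc.total ha hb with h | h
        · exact ⟨_, ⟨b, hb, rfl⟩, h, le_rfl⟩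
        · exact ⟨_, ⟨a, ha, rfl⟩, le_rfl, h⟩
      · rintro ⟨a, ha, h⟩
        exact (hcZ ha).1.ne h
    · exact (sInf_le (α := Filter V) (Set.mem_image_of_mem OrderDual.ofDual hy)).trans
        (hcZ hy).2.1
    · intro v
      refine le_sInf ?_
      rintro _ ⟨a, ha, rfl⟩
      exact ((hcZ ha).2.2 v).mono_left
        (sInf_le (α := Filter V) (Set.mem_image_of_mem OrderDual.ofDual ha))
    · exact fun a ha => sInf_le (α := Filter V) ⟨a, ha, rfl⟩) _ hcof
  obtain ⟨⟨hne, hle, hinv⟩, hmax⟩ := hm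
  refine ⟨OrderDual.ofDual m, hne, hle, hinv, fun A hA => ?_⟩
  set l : Filter V := OrderDual.ofDual m
  by_contra! hcon
  -- If `A` is not syndetic, all translates of its complement can be adjoined, keeping the filter
  -- proper and invariant.
  let g : Filter V := l ⊓ ⨅ h : V, 𝓟 {v | v + h ∉ A}
  have hg : OrderDual.toDual g ∈ Z := by
    refine ⟨?_, inf_le_left.trans hle, fun w => ?_⟩
    · refine (l.basis_sets.inf_basis_neBot_iff (hasBasis_iInf_principal_finite _)).2 ?_
      intro s hs t ht
      obtain ⟨v, hv, hvs⟩ := ((hcon ht.toFinset).and_eventually hs).exists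
      exact ⟨v, hvs, Set.mem_iInter₂.2 fun h hh => hv h (ht.mem_toFinset.2 hh)⟩
    · refine tendsto_inf.2 ⟨(hinv w).mono_left inf_le_left, tendsto_iInf.2 fun h => ?_⟩
      refine Tendsto.mono_left ?_ (inf_le_right.trans (iInf_le _ (w + h)))
      refine tendsto_principal_principal.2 fun v hv => ?_
      simpa [add_assoc] using hv
  have hlg : l ≤ g := hmax hg (inf_le_left (a := l))
  have h0 : ∀ᶠ v in l, v ∉ A := by
    have : {v | v + (0 : V) ∉ A} ∈ l :=
      (hlg.trans (inf_le_right.trans (iInf_le _ (0 : V)))) (mem_principal_self _)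
    filter_upwards [this] with v hv
    rwa [add_zero] at hv
  exact hA h0

open Filter in
/-- The Gallai–Brown property of frequent sets, deduced from the Hales–Jewett theorem. -/
theorem exists_frequently_homothetic {V : Type*} [AddCommGroup V] {l : Filter V}
    (hinv : ∀ v, Tendsto (· + v) l l)
    (hsyn : ∀ A : Set V, (∃ᶠ v in l, v ∈ A) → ∃ H : Finset V, ∀ᶠ v in l, ∃ h ∈ H, v + h ∈ A)
    {A : Set V} (hA : ∃ᶠ v in l, v ∈ A) (S : Finset V) :
    ∃ n : ℕ, 0 < n ∧ ∃ᶠ v in l, ∀ s ∈ S, v + n • s ∈ A := by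
  classical
  obtain ⟨H, hH⟩ := hsyn A hA
  obtain ⟨ι, _, hι⟩ := Combinatorics.Line.exists_mono_in_high_dimension S H
  by_contra! hcon
  let base : (ι → Option S) → V := fun k => ∑ i, (k i).elim 0 (fun s => (s : V))
  let act : (ι → Option S) → ℕ := fun k => (Finset.univ.filter fun i => k i = none).card
  have hall : ∀ᶠ v in l, ∀ w : ι → S, ∃ h ∈ H, (v + ∑ i, (w i : V)) + h ∈ A :=
    eventually_all.2 fun w => (hinv (∑ i, (w i : V))).eventually hH
  -- There are finitely many pairs of a line and a shift, so one `v` avoids all of them.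
  have hbad : ∀ᶠ v in l, ∀ (k : ι → Option S) (h : H), 0 < act k →
      ¬ ∀ s ∈ S, v + (base k + h) + act k • s ∈ A := by
    refine eventually_all.2 fun k => eventually_all.2 fun h => ?_
    by_cases hk : 0 < act k
    · filter_upwards [(hinv (base k + h)).eventually (hcon _ hk)] with v hv _ hs
      obtain ⟨s, hsS, hsA⟩ := hv
      exact hsA (hs s hsS)
    · exact Eventually.of_forall fun v h => absurd h hk
  obtain ⟨v, -, hv, hvbad⟩ := (hA.and_eventually (hall.and hbad)).exists
  choose col hcolH hcol using hv
  obtain ⟨L, h, hL⟩ := hι fun w => ⟨col w, hcolH w⟩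
  refine hvbad L.idxFun h ?_ fun s hs => ?_
  · obtain ⟨i, hi⟩ := L.proper
    exact Finset.card_pos.2 ⟨i, by simpa using hi⟩
  · have h1 := hcol (fun i => L ⟨s, hs⟩ i)
    have h2 : col (fun i => L ⟨s, hs⟩ i) = h := congrArg Subtype.val (hL ⟨s, hs⟩)
    have h3 : ∑ i, ((L ⟨s, hs⟩ i : S) : V) = base L.idxFun + act L.idxFun • s := by
      simp only [base, act, Finset.card_filter, Finset.sum_smul, ← Finset.sum_add_distrib]
      refine Finset.sum_congr rfl fun i _ => ?_
      rw [Combinatorics.Line.apply_def]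
      rcases hi : L.idxFun i with _ | a <;> simp [hi]
    rw [h2, h3] at h1
    convert h1 using 1
    abel

open Filter in
/-- Either the desired pattern exists, or there is a frequent set of polynomials `A` and
arbitrarily many colours, each of which is constantly attained on some multiple `g t * A`. -/
theorem exists_pattern_or_coloured_multiples (F : Finset ℕ) {r : ℕ} (col : ℚ[X] → Fin r)
    {l : Filter ℚ[X]} [l.NeBot] (hcof : l ≤ cofinite) (hinv : ∀ v, Tendsto (· + v) l l)
    (hsyn : ∀ A : Set ℚ[X], (∃ᶠ v in l, v ∈ A) →
      ∃ H : Finset ℚ[X], ∀ᶠ v in l, ∃ h ∈ H, v + h ∈ A) (n : ℕ) :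
    (∃ x ∈ polySpaceOne, ∃ y ∈ polySpaceOne, ∃ k, (x * y ∈ polySpaceOne ∧ col (x * y) = k) ∧
      ∀ f ∈ F, x + (1 / (f : ℚ)) • y ∈ polySpaceOne ∧ col (x + (1 / (f : ℚ)) • y) = k) ∨
    ∃ (L : Finset (Fin r)) (g : Fin r → ℚ[X]) (m : ℚ[X]) (A : Set ℚ[X]), L.card = n ∧ m ≠ 0 ∧
      X ∣ m ∧ (∃ᶠ v in l, v ∈ A) ∧
      ∀ t ∈ L, X ∣ g t ∧ g t ∣ m ∧ ∀ b ∈ A, col (g t * b) = t := by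
  classical
  have hmem : ∀ p : ℚ[X], X ∣ p → p ≠ 0 → p ∈ polySpaceOne := fun p h1 h2 =>
    (mem_polySpaceOne_iff p).2 ⟨X_dvd_iff.1 h1, h2⟩
  induction n with
  | zero =>
    exact Or.inr ⟨∅, 0, X, Set.univ, by simp, X_ne_zero, dvd_rfl,
      (Eventually.of_forall fun _ => trivial).frequently, by simp⟩
  | succ n ih =>
    rcases ih with h | ⟨L, g, m, A, hcard, hm, hXm, hA, hL⟩
    · exact Or.inl h
    have hdvd : ∀ t : L, ∃ k, m = g t * k := fun t => (hL t t.2).2.1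
    choose k hk using hdvd
    -- Including `0` forces `v ∈ A`, so the new frequent set lies in `A`.
    let S : Finset ℚ[X] := insert 0
      ((Finset.univ ×ˢ F).image fun p : L × ℕ => (1 / (p.2 : ℚ)) • (k p.1) ^ 2)
    obtain ⟨N, hN, hD⟩ := exists_frequently_homothetic hinv hsyn hA S
    let m' : ℚ[X] := m ^ 2 * N
    have hN0 : (N : ℚ[X]) ≠ 0 := Nat.cast_ne_zero.2 hN.ne'
    have hm' : m' ≠ 0 := mul_ne_zero (pow_ne_zero _ hm) hN0
    have hmm' : m ∣ m' := ⟨m * N, by simp only [m']; ring⟩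
    obtain ⟨t, ht⟩ : ∃ t, ∃ᶠ v in l, (∀ s ∈ S, v + N • s ∈ A) ∧ col (m' * v) = t := by
      by_contra! hcon
      refine hD ?_
      have := eventually_all.2 hcon
      filter_upwards [this] with v hv hs
      exact hv _ hs rfl
    have hsub : ∀ v, (∀ s ∈ S, v + N • s ∈ A) → v ∈ A := fun v hv => by
      simpa using hv 0 (Finset.mem_insert_self _ _)
    by_cases htL : t ∈ L
    · left
      -- Discarding finitely many `v` makes `x` and every `x + y / f` nonzero.
      obtain ⟨v, ⟨hv, hvt⟩, hvbad⟩ := (ht.and_eventually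
        (hcof (S.image fun s => -(N • s)).finite_toSet.compl_mem_cofinite)).exists
      have hvne : ∀ s ∈ S, v + N • s ≠ 0 := fun s hs h =>
        hvbad (Finset.mem_coe.2 (Finset.mem_image.2 ⟨s, hs, (eq_neg_of_add_eq_zero_left h).symm⟩))
      have hv0 : v ≠ 0 := by simpa using hvne 0 (Finset.mem_insert_self _ _)
      obtain ⟨hXg, -, hgA⟩ := hL t htL
      have hkt : m = g t * k ⟨t, htL⟩ := hk ⟨t, htL⟩
      have hg0 : g t ≠ 0 := by
        intro h
        rw [h, zero_mul] at hkt
        exact hm hkt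
      have hk0 : k ⟨t, htL⟩ ≠ 0 := by
        intro h
        rw [h, mul_zero] at hkt
        exact hm hkt
      have hxy : g t * v * (g t * k ⟨t, htL⟩ ^ 2 * N) = m' * v := by
        simp only [m', hkt]
        ring
      refine ⟨g t * v, hmem _ (hXg.mul_right _) (mul_ne_zero hg0 hv0),
        g t * k ⟨t, htL⟩ ^ 2 * N,
        hmem _ ((hXg.mul_right _).mul_right _)
          (mul_ne_zero (mul_ne_zero hg0 (pow_ne_zero _ hk0)) hN0), t, ?_, fun f hf => ?_⟩
      · rw [hxy]
        exact ⟨hmem _ ((hXm.trans hmm').mul_right _) (mul_ne_zero hm' hv0), hvt⟩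
      · have hs : (1 / (f : ℚ)) • k ⟨t, htL⟩ ^ 2 ∈ S := Finset.mem_insert_of_mem
          (Finset.mem_image.2 ⟨(⟨t, htL⟩, f), by simpa using hf, rfl⟩)
        have hsum : g t * v + (1 / (f : ℚ)) • (g t * k ⟨t, htL⟩ ^ 2 * N) =
            g t * (v + N • (1 / (f : ℚ)) • k ⟨t, htL⟩ ^ 2) := by
          simp only [smul_eq_C_mul, nsmul_eq_mul]
          ring
        rw [hsum]
        exact ⟨hmem _ (hXg.mul_right _) (mul_ne_zero hg0 (hvne _ hs)), hgA _ (hv _ hs)⟩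
    · right
      refine ⟨insert t L, Function.update g t m', m',
        {v | (∀ s ∈ S, v + N • s ∈ A) ∧ col (m' * v) = t}, by
          rw [Finset.card_insert_of_notMem htL, hcard], hm', hXm.trans hmm', ht, fun t' ht' => ?_⟩
      by_cases htt : t' = t
      · subst htt
        rw [Function.update_self]
        exact ⟨hXm.trans hmm', dvd_rfl, fun b hb => hb.2⟩
      · rw [Function.update_of_ne htt]
        obtain ⟨h1, h2, h3⟩ := hL t' (Finset.mem_of_mem_insert_of_ne ht' htt)
        exact ⟨h1, h2.trans hmm', fun b hb => h3 b (hsub b hb.1)⟩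

theorem mainTheorem10 (F : Finset ℕ) (hF : ∀ f ∈ F, 0 < f) (r : ℕ)
    (c : polySpaceOne → Fin r) :
    ∃ x ∈ polySpaceOne, ∃ y ∈ polySpaceOne,
      IsMonochromatic c ({x * y} ∪ {z | ∃ f ∈ F, z = x + (1 / (f : ℚ)) • y}) := by
  classical
  have hX : (X : ℚ[X]) ∈ polySpaceOne := (mem_polySpaceOne_iff X).2 ⟨by simp, X_ne_zero⟩
  let col : ℚ[X] → Fin r := fun p => if h : p ∈ polySpaceOne then c ⟨p, h⟩ else c ⟨X, hX⟩
  have hcol : ∀ p (h : p ∈ polySpaceOne), col p = c ⟨p, h⟩ := fun p h => dif_pos h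
  obtain ⟨l, hne, hcof, hinv, hsyn⟩ := exists_invariant_filter ℚ[X]
  rcases exists_pattern_or_coloured_multiples F col hcof hinv hsyn (r + 1) with
    ⟨x, hx, y, hy, k, ⟨hxy, hk⟩, hf⟩ | ⟨L, -, -, -, hL, -⟩
  · refine ⟨x, hx, y, hy, k, ?_⟩
    rintro p (rfl | ⟨f, hfF, rfl⟩)
    · exact ⟨hxy, (hcol _ hxy).symm.trans hk⟩
    · exact ⟨(hf f hfF).1, (hcol _ (hf f hfF).1).symm.trans (hf f hfF).2⟩
  · have := L.card_le_univ
    rw [hL, Fintype.card_fin] at this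
    omega
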